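/- Let $K$ be an infinite field, $n\ge 2$, $S=K[x_1,\dots,x_n]$, and let $I\subseteq S$ be a nonzero monomial ideal. Let $G(I)$ be its minimal set of monomial generators and $\deg(I)$ the highest degree of an element of $G(I)$. Let $\operatorname{reg}(I)=\max\{j-i : \beta_{ij}(I)\neq 0\}$, where $\beta_{ij}(I)=\dim_K \operatorname{Tor}_i^S(K,I)_j$ are the graded Betti numbers of $I$. For an integer $e\ge 0$ let $I_{\ge e}$ be the ideal generated by the homogeneous elements of $I$ of degree at least $e$. The ideal $I$ is of Borel type if $(I:x_j^\infty)=(I:(x_1,\dots,x_j)^\infty)$ for all $j=1,\dots,n$. A monomial ideal $J$ is stable if for every monomial $u\in J$ with $u\neq 1$ and every $j<m(u)$, where $m(u)=\max\{i : x_i\mid u\}$, one has $x_j u/x_{m(u)}\in J$. Then the following are equivalent: 1. $I$ is of Borel type. 2. $I_{\ge \operatorname{reg}(I)}$ is stable. 3. There exists an integer $e\ge\deg(I)$ such that $I_{\ge e}$ is stable. If one of these conditions holds, then $\operatorname{reg}(I)=\min\{e : e\ge\deg(I),\ I_{\ge e}\text{ is stable}\}$. -/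

import Mathlib

namespace BorelType

open MvPolynomial

/-- `I` is a monomial ideal: it is generated by a set of monomials (given by exponent vectors). -/
def IsMonomialIdeal {K : Type*} [Field K] {n : ℕ} (I : Ideal (MvPolynomial (Fin n) K)) : Prop :=
  ∃ A : Set (Fin n →₀ ℕ), I = Ideal.span ((fun a => monomial a (1 : K)) '' A)

/-- The exponent vectors of the minimal monomial generators `G(I)` of a monomial ideal `I`:
the monomials of `I` that are minimal with respect to divisibility. -/
def minimalGenerators {K : Type*} [Field K] {n : ℕ} (I : Ideal (MvPolynomial (Fin n) K)) :
    Set (Fin n →₀ ℕ) :=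
  {a | Minimal (fun b : Fin n →₀ ℕ => monomial b (1 : K) ∈ I) a}

/-- `deg(I)`, the highest degree of a minimal monomial generator of `I`
(a maximum over a finite set, which is nonempty when the monomial ideal `I` is nonzero). -/
noncomputable def maxGenDegree {K : Type*} [Field K] {n : ℕ}
    (I : Ideal (MvPolynomial (Fin n) K)) : ℕ :=
  sSup (Finsupp.degree '' minimalGenerators I)

/-- The saturation `(I : J^∞) = ⋃ k, (I : J^k)`; the ideals `(I : J^k)` form an ascending chain,
so that their union is their supremum. -/
noncomputable def saturation {K : Type*} [Field K] {n : ℕ}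
    (I J : Ideal (MvPolynomial (Fin n) K)) : Ideal (MvPolynomial (Fin n) K) :=
  ⨆ k : ℕ, Submodule.colon I ((J ^ k : Ideal (MvPolynomial (Fin n) K)) : Set _)

/-- The monomial ideal `I` is of Borel type: `(I : x_j^∞) = (I : (x_1, …, x_j)^∞)` for all `j`. -/
def IsBorelType {K : Type*} [Field K] {n : ℕ} (I : Ideal (MvPolynomial (Fin n) K)) : Prop :=
  ∀ j : Fin n,
    saturation I (Ideal.span {X j}) = saturation I (Ideal.span (X '' Set.Iic j))

/-- The truncation `I_{≥ e}`: the ideal generated by the homogeneous elements of `I` of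
degree at least `e`. -/
noncomputable def truncation {K : Type*} [Field K] {n : ℕ} (I : Ideal (MvPolynomial (Fin n) K)) (e : ℕ) :
    Ideal (MvPolynomial (Fin n) K) :=
  Ideal.span {f | f ∈ I ∧ ∃ d, e ≤ d ∧ f.IsHomogeneous d}

/-- The monomial ideal `I` is stable: for every monomial `u = x^a` in `I`, with
`m = m(u)` the largest index of a variable dividing `u`, and every `j < m`,
the monomial `x_j u / x_m` lies in `I`. -/
def IsStable {K : Type*} [Field K] {n : ℕ} (I : Ideal (MvPolynomial (Fin n) K)) : Prop :=
  ∀ a : Fin n →₀ ℕ, monomial a (1 : K) ∈ I →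
    ∀ m : Fin n, IsGreatest (a.support : Set (Fin n)) m →
      ∀ j : Fin n, j < m →
        monomial (a - Finsupp.single m 1 + Finsupp.single j 1) (1 : K) ∈ I

/-- The differential of the Koszul complex of `x_1, …, x_n` over `S = K[x_1, …, x_n]`.
An element `∑_F c_F e_F` of the exterior algebra on `e_1, …, e_n` over `S` is written as the
function `F ↦ c_F`; then `∂ e_F = ∑_{k ∈ F} (-1)^{#{l ∈ F | l < k}} x_k e_{F \ {k}}`, i.e. the
coefficient of `∂ c` at `G` collects the terms from `F = G ∪ {k}` with `k ∉ G`. -/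
noncomputable def koszulD (K : Type*) [Field K] (n : ℕ) :
    (Finset (Fin n) → MvPolynomial (Fin n) K) →ₗ[MvPolynomial (Fin n) K]
      (Finset (Fin n) → MvPolynomial (Fin n) K) :=
  LinearMap.pi fun G => ∑ k ∈ Gᶜ,
    ((-1) ^ (G.filter (· < k)).card * X k : MvPolynomial (Fin n) K) •
      LinearMap.proj (R := MvPolynomial (Fin n) K)
        (φ := fun _ : Finset (Fin n) => MvPolynomial (Fin n) K) (insert k G)

/-- The component of homological degree `i` and internal degree `j` of the Koszul complex with
coefficients in `I`: combinations `∑ c_F e_F` over the `i`-element sets `F`, where `c_F ∈ I` is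
homogeneous of degree `j - i` (as `e_F` has degree `i`; this is `0` if `j < i`). -/
noncomputable def koszulChains {K : Type*} [Field K] {n : ℕ} (I : Ideal (MvPolynomial (Fin n) K)) (i j : ℕ) :
    Submodule K (Finset (Fin n) → MvPolynomial (Fin n) K) :=
  Submodule.pi Set.univ fun F =>
    I.restrictScalars K ⊓ restrictSupport K {a | F.card = i ∧ a.degree + i = j}

/-- Cycles in homological degree `i` and internal degree `j`. -/
noncomputable def koszulCycles {K : Type*} [Field K] {n : ℕ}
    (I : Ideal (MvPolynomial (Fin n) K)) (i j : ℕ) :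
    Submodule K (Finset (Fin n) → MvPolynomial (Fin n) K) :=
  koszulChains I i j ⊓ LinearMap.ker ((koszulD K n).restrictScalars K)

/-- Boundaries in homological degree `i` and internal degree `j`. -/
noncomputable def koszulBoundaries {K : Type*} [Field K] {n : ℕ}
    (I : Ideal (MvPolynomial (Fin n) K)) (i j : ℕ) :
    Submodule K (Finset (Fin n) → MvPolynomial (Fin n) K) :=
  (koszulChains I (i + 1) j).map ((koszulD K n).restrictScalars K)

theorem koszulD_apply {K : Type*} [Field K] {n : ℕ} (c : Finset (Fin n) → MvPolynomial (Fin n) K)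
    (G : Finset (Fin n)) :
    koszulD K n c G = ∑ k ∈ Gᶜ, (-1) ^ (G.filter (· < k)).card * X k * c (insert k G) := by
  simp [koszulD, LinearMap.sum_apply]

theorem koszul_sign {R : Type*} [CommRing R] {n : ℕ} (G : Finset (Fin n)) (k l : Fin n)
    (hk : k ∉ G)
    (h : k < l) :
    ((-1 : R) ^ (G.filter (· < k)).card) * (-1) ^ ((insert k G).filter (· < l)).card
     = - (((-1) ^ (G.filter (· < l)).card) * (-1) ^ ((insert l G).filter (· < k)).card) := by
  rw [Finset.filter_insert, Finset.filter_insert, if_pos h, if_neg h.not_gt,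
    Finset.card_insert_of_notMem (by simp [hk])]
  ring

theorem koszulD_koszulD {K : Type*} [Field K] {n : ℕ}
    (c : Finset (Fin n) → MvPolynomial (Fin n) K) : koszulD K n (koszulD K n c) = 0 := by
  funext G
  simp only [koszulD_apply, Finset.mul_sum, Pi.zero_apply]
  rw [Finset.sum_sigma']
  refine Finset.sum_involution (fun p _ => ⟨p.2, p.1⟩) ?_ ?_ ?_ ?_
  · rintro ⟨k, l⟩ h
    simp only [Finset.mem_sigma, Finset.mem_compl, Finset.mem_insert, not_or] at h
    obtain ⟨hk, hlk, hl⟩ := h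
    dsimp only
    rw [Finset.insert_comm l k G]
    rcases lt_or_gt_of_ne hlk with h | h
    · have := koszul_sign (R := MvPolynomial (Fin n) K) G l k hl h
      linear_combination (X k * X l * c (insert k (insert l G))) * this
    · have := koszul_sign (R := MvPolynomial (Fin n) K) G k l hk h
      linear_combination (X k * X l * c (insert k (insert l G))) * this
  · rintro ⟨k, l⟩ h _ he
    simp only [Finset.mem_sigma, Finset.mem_compl, Finset.mem_insert, not_or] at h
    simp only [Sigma.mk.injEq] at he
    exact h.2.1 he.1
  · rintro ⟨k, l⟩ h
    simp only [Finset.mem_sigma, Finset.mem_compl, Finset.mem_insert, not_or] at h ⊢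
    exact ⟨h.2.2, fun e => h.2.1 e.symm, h.1⟩
  · rintro ⟨k, l⟩ h; rfl

theorem koszulD_mem_koszulChains {K : Type*} [Field K] {n : ℕ}
    (I : Ideal (MvPolynomial (Fin n) K)) (i j : ℕ) (c : Finset (Fin n) → MvPolynomial (Fin n) K)
    (hc : c ∈ koszulChains I (i + 1) j) : koszulD K n c ∈ koszulChains I i j := by
  intro G _
  rw [koszulD_apply]
  refine Submodule.sum_mem _ fun k hk => ?_
  obtain ⟨h1, h2⟩ := hc (insert k G) trivial
  refine ⟨I.mul_mem_left _ h1, ?_⟩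
  rw [SetLike.mem_coe, mem_restrictSupport_iff] at h2 ⊢
  have hG : k ∉ G := by simpa using hk
  rw [mul_assoc]
  have key : ∀ q : MvPolynomial (Fin n) K, ∀ t : ℕ, ((-1) ^ t * q).support = q.support := by
    intro q t
    rcases neg_one_pow_eq_or (MvPolynomial (Fin n) K) t with h | h <;> simp [h, support_neg]
  intro a ha
  rw [key, SetLike.mem_coe, support_X_mul] at ha
  simp only [Finset.mem_map, addLeftEmbedding_apply] at ha
  obtain ⟨b, hb, rfl⟩ := ha
  have := h2 hb
  simp only [Set.mem_ofPred_eq, Finset.card_insert_of_notMem hG] at this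
  simp only [Set.mem_ofPred_eq, map_add, Finsupp.degree_single]
  omega

theorem koszulBoundaries_le_koszulCycles {K : Type*} [Field K] {n : ℕ}
    (I : Ideal (MvPolynomial (Fin n) K)) (i j : ℕ) :
    koszulBoundaries I i j ≤ koszulCycles I i j := by
  rintro _ ⟨c, hc, rfl⟩
  exact ⟨koszulD_mem_koszulChains I i j c hc, koszulD_koszulD c⟩

/-- The graded Betti number `β_{ij}(I) = dim_K Tor_i^S(K, I)_j`, where `Tor` is computed
from the Koszul complex, the standard graded free resolution of `K = S/(x_1, …, x_n)`. -/
noncomputable def gradedBetti {K : Type*} [Field K] {n : ℕ}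
    (I : Ideal (MvPolynomial (Fin n) K)) (i j : ℕ) : ℕ :=
  Module.finrank K (koszulCycles I i j ⧸ (koszulBoundaries I i j).submoduleOf (koszulCycles I i j))

/-- The Castelnuovo-Mumford regularity `reg(I) = max {j - i | β_{ij}(I) ≠ 0}`. (Always `i ≤ j` when
`β_{ij}(I) ≠ 0`; the set is finite, and it is nonempty for a nonzero homogeneous ideal `I`.) -/
noncomputable def regularity {K : Type*} [Field K] {n : ℕ}
    (I : Ideal (MvPolynomial (Fin n) K)) : ℕ :=
  sSup {r | ∃ i j : ℕ, gradedBetti I i j ≠ 0 ∧ j = i + r}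

end BorelType

/-! A monomial ideal is determined by the exponent vectors it contains, so every condition becomes
combinatorial. The Koszul complex splits by multidegree `a` into the augmented chain complexes of
the upper Koszul complexes, so `β_{ij}(I) ≠ 0` exactly when one of these with `|a| = j` has homology
on faces of size `i` (`gradedBetti_ne_zero_iff`). Stability in high degrees lets later variables be
traded for `x_i`, which gives Borel type (`isBorelType_of_isStable_truncation`). Minimal generators
give classes with `i = 0`, so `deg(I) ≤ reg(I)`. If `I_{≥ e}` is stable with `e ≥ deg(I)`, every
complex with `j - i > e` behaves as a cone over the last variable of `a`, so `reg(I) ≤ e`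
(`regularity_le_of_isStable_truncation`). Conversely, if `I` is of Borel type, a failure of
stability at a monomial of degree `d` extends to a socle monomial of degree at least `d`
(`IsBorelType.exists_socle`). This yields a hollow simplex, forcing `reg(I) > d`
(`degree_lt_regularity_of_socle`). -/

namespace BorelType

open MvPolynomial

/-! ### Monomial ideals, truncations and saturations -/

section Monomials

variable {K : Type*} [Field K] {n : ℕ} {I : Ideal (MvPolynomial (Fin n) K)}

/-- The exponent vectors of the monomials lying in `I`. -/
def exponents (I : Ideal (MvPolynomial (Fin n) K)) : Set (Fin n →₀ ℕ) :=
  {a | monomial a (1 : K) ∈ I}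

theorem exponents_mono {a b : Fin n →₀ ℕ} (ha : a ∈ exponents I) (hab : a ≤ b) :
    b ∈ exponents I := by
  obtain ⟨c, rfl⟩ := exists_add_of_le hab
  have := I.mul_mem_left (monomial c (1 : K)) ha
  rwa [monomial_mul, mul_one, add_comm] at this

theorem monomial_mem_of_mem_exponents {a : Fin n →₀ ℕ} (ha : a ∈ exponents I) (r : K) :
    monomial a r ∈ I := by
  have := I.mul_mem_left (C r) ha
  rwa [C_mul_monomial, mul_one] at this

theorem IsMonomialIdeal.mem_iff (hI : IsMonomialIdeal I) {f : MvPolynomial (Fin n) K} :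
    f ∈ I ↔ ∀ a ∈ f.support, a ∈ exponents I := by
  refine ⟨fun hf a ha => ?_, fun h => ?_⟩
  · obtain ⟨A, rfl⟩ := hI
    obtain ⟨b, hb, hba⟩ := mem_ideal_span_monomial_image.1 hf a ha
    exact exponents_mono (Ideal.subset_span ⟨b, hb, rfl⟩) hba
  · rw [f.as_sum]
    exact I.sum_mem fun a ha => monomial_mem_of_mem_exponents (h a ha) _

theorem IsMonomialIdeal.X_pow_mul_mem_iff (hI : IsMonomialIdeal I) {f : MvPolynomial (Fin n) K}
    (i : Fin n) (k : ℕ) :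
    X i ^ k * f ∈ I ↔ ∀ a ∈ f.support, Finsupp.single i k + a ∈ exponents I := by
  rw [hI.mem_iff, X_pow_eq_monomial]
  refine ⟨fun h a ha => h _ ?_, fun h b hb => ?_⟩
  · rwa [mem_support_iff, coeff_monomial_mul, one_mul, ← mem_support_iff]
  · rw [mem_support_iff, coeff_monomial_mul', one_mul] at hb
    split_ifs at hb with hle
    · rw [← add_tsub_cancel_of_le hle]
      exact h _ (mem_support_iff.2 hb)
    · exact absurd rfl hb

theorem exists_minimalGenerator_le {a : Fin n →₀ ℕ} (ha : a ∈ exponents I) :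
    ∃ b ≤ a, b ∈ minimalGenerators I :=
  exists_minimal_le_of_wellFoundedLT (fun b : Fin n →₀ ℕ => monomial b (1 : K) ∈ I) a ha

/-- Dickson's lemma: divisibility of monomials is a well-quasi-order, so antichains are finite. -/
theorem finite_minimalGenerators : (minimalGenerators I).Finite :=
  WellQuasiOrderedLE.finite_of_isAntichain (setOfPred_minimal_antichain _)

theorem degree_le_maxGenDegree {a : Fin n →₀ ℕ} (ha : a ∈ minimalGenerators I) :
    a.degree ≤ maxGenDegree I :=
  le_csSup (finite_minimalGenerators.image _).bddAbove ⟨a, ha, rfl⟩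

theorem exists_tsub_single_mem_exponents {a : Fin n →₀ ℕ} (ha : a ∈ exponents I)
    (h : maxGenDegree I < a.degree) : ∃ k ∈ a.support, a - Finsupp.single k 1 ∈ exponents I := by
  obtain ⟨b, hba, hb⟩ := exists_minimalGenerator_le ha
  have hne : b ≠ a := by
    rintro rfl
    exact absurd (degree_le_maxGenDegree hb) h.not_ge
  obtain ⟨k, hk⟩ : ∃ k, b k < a k := by
    by_contra! hcon
    exact hne (le_antisymm hba hcon)
  refine ⟨k, Finsupp.mem_support_iff.2 (by omega), exponents_mono hb.1 fun i => ?_⟩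
  have := hba i
  rcases eq_or_ne i k with rfl | hik
  · simp only [Finsupp.tsub_apply, Finsupp.single_eq_same]
    omega
  · simpa [Finsupp.tsub_apply, Finsupp.single_eq_of_ne hik] using this

/-- No minimal generator has an exponent above `deg(I)`, so beyond that value the exponent at `k` no
longer affects membership. -/
theorem exists_exponent_bound (I : Ideal (MvPolynomial (Fin n) K)) :
    ∃ B : ℕ, ∀ a b : Fin n →₀ ℕ, ∀ k : Fin n, a ∈ exponents I → B ≤ b k →
      (∀ i, i ≠ k → a i ≤ b i) → b ∈ exponents I := by
  refine ⟨maxGenDegree I, fun a b k ha hb hab => ?_⟩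
  obtain ⟨g, hga, hg⟩ := exists_minimalGenerator_le ha
  refine exponents_mono hg.1 fun i => ?_
  rcases eq_or_ne i k with rfl | hik
  · exact (Finsupp.le_degree i g).trans ((degree_le_maxGenDegree hg).trans hb)
  · exact (hga i).trans (hab i hik)

theorem mem_exponents_truncation {e : ℕ} {a : Fin n →₀ ℕ} :
    a ∈ exponents (truncation I e) ↔ a ∈ exponents I ∧ e ≤ a.degree := by
  refine ⟨fun h => ⟨?_, ?_⟩, fun h => Ideal.subset_span
    ⟨h.1, a.degree, h.2, isHomogeneous_monomial _ rfl⟩⟩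
  · exact Ideal.span_le.2 (fun f hf => hf.1) h
  · have hup : IsUpperSet {b : Fin n →₀ ℕ | e ≤ b.degree} :=
      fun b c hbc hb => le_trans hb (Finsupp.degree_mono hbc)
    have hle : truncation I e ≤ restrictSupportIdeal K _ hup := by
      refine Ideal.span_le.2 ?_
      rintro f ⟨-, d, hd, hf⟩
      change f ∈ restrictSupport K {b : Fin n →₀ ℕ | e ≤ b.degree}
      rw [mem_restrictSupport_iff]
      intro b hb
      have := hf.degree_eq_sum_deg_support hb
      change e ≤ b.degree
      rwa [Finsupp.degree_apply, ← this]
    have h2 : monomial a (1 : K) ∈ restrictSupport K {b : Fin n →₀ ℕ | e ≤ b.degree} := hle h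
    rw [mem_restrictSupport_iff] at h2
    exact h2 (by simp)

theorem isStable_truncation_iff {e : ℕ} : IsStable (truncation I e) ↔
    ∀ a ∈ exponents I, e ≤ a.degree → ∀ m : Fin n, IsGreatest (a.support : Set (Fin n)) m →
      ∀ j < m, a - Finsupp.single m 1 + Finsupp.single j 1 ∈ exponents I := by
  refine ⟨fun h a ha hae m hm j hj => (mem_exponents_truncation.1
    (h a (mem_exponents_truncation.2 ⟨ha, hae⟩) m hm j hj)).1, fun h a ha m hm j hj => ?_⟩
  obtain ⟨ha, hae⟩ := mem_exponents_truncation.1 ha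
  refine mem_exponents_truncation.2 ⟨h a ha hae m hm j hj, ?_⟩
  have hle : Finsupp.single m 1 ≤ a := by
    simpa [Nat.one_le_iff_ne_zero] using hm.1
  have := congrArg Finsupp.degree (tsub_add_cancel_of_le hle)
  simp only [map_add, Finsupp.degree_single] at this ⊢
  omega

/-- The condition says that `s` lies in the radical of `(I : f)`; by noetherianity a single power of
the span then lies in `(I : f)`. -/
theorem mem_saturation_span_iff {s : Set (MvPolynomial (Fin n) K)} {f : MvPolynomial (Fin n) K} :
    f ∈ saturation I (Ideal.span s) ↔ ∀ g ∈ s, ∃ k : ℕ, g ^ k * f ∈ I := by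
  have hdir : Directed (· ≤ ·) fun k : ℕ =>
      Submodule.colon I ((Ideal.span s ^ k : Ideal (MvPolynomial (Fin n) K)) : Set _) :=
    Monotone.directed_le fun k l hkl =>
      Submodule.colon_mono le_rfl (Ideal.pow_le_pow_right hkl)
  rw [saturation, Submodule.mem_iSup_of_directed _ hdir]
  constructor
  · rintro ⟨k, hk⟩ g hg
    refine ⟨k, ?_⟩
    rw [mul_comm]
    exact Submodule.mem_colon.1 hk _ (Ideal.pow_mem_pow (Ideal.subset_span hg) k)
  · intro h
    have hrad : Ideal.span s ≤ (Submodule.colon I {f}).radical := Ideal.span_le.2 fun g hg => by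
      obtain ⟨k, hk⟩ := h g hg
      exact ⟨k, Submodule.mem_colon_singleton.2 hk⟩
    obtain ⟨k, hk⟩ := Ideal.exists_pow_le_of_le_radical_of_fg hrad (IsNoetherian.noetherian _)
    refine ⟨k, Submodule.mem_colon.2 fun p hp => ?_⟩
    have := Submodule.mem_colon_singleton.1 (hk hp)
    rwa [smul_eq_mul, mul_comm] at this

theorem isBorelType_iff : IsBorelType I ↔
    ∀ i j : Fin n, i ≤ j → ∀ f : MvPolynomial (Fin n) K,
      (∃ k : ℕ, X j ^ k * f ∈ I) → ∃ k : ℕ, X i ^ k * f ∈ I := by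
  constructor
  · intro h i j hij f hf
    have : f ∈ saturation I (Ideal.span {X j}) := mem_saturation_span_iff.2 (by simpa using hf)
    rw [h j] at this
    exact mem_saturation_span_iff.1 this _ ⟨i, hij, rfl⟩
  · intro h j
    ext f
    rw [mem_saturation_span_iff, mem_saturation_span_iff]
    constructor
    · rintro hf _ ⟨i, hi, rfl⟩
      exact h i j hi f (hf _ rfl)
    · rintro hf _ rfl
      exact hf _ ⟨j, Set.mem_Iic.2 le_rfl, rfl⟩

/-- In a set of monomials that is stable in degrees `≥ e`, the variables after `x_i` can be
traded for powers of `x_i`. -/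
theorem exists_mem_exponents_of_stable {e : ℕ} (hst : IsStable (truncation I e)) (i : Fin n)
    {a : Fin n →₀ ℕ} (ha : a ∈ exponents I) (hae : e ≤ a.degree) :
    ∃ b ∈ exponents I, (∀ l < i, b l = a l) ∧ ∀ l, i < l → b l = 0 := by
  -- Each exchange of the last variable for `x_i` lowers the total exponent beyond `i` by one and
  -- preserves the degree, so stability stays applicable.
  induction hs : ∑ l ∈ Finset.Ioi i, a l generalizing a with
  | zero =>
    refine ⟨a, ha, fun _ _ => rfl, fun l hl => ?_⟩
    exact Finset.sum_eq_zero_iff.1 hs l (Finset.mem_Ioi.2 hl)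
  | succ t ih =>
    obtain ⟨l, hl, hl0⟩ : ∃ l ∈ Finset.Ioi i, a l ≠ 0 :=
      Finset.exists_ne_zero_of_sum_ne_zero (by omega)
    obtain ⟨m, hm⟩ : ∃ m, IsGreatest (a.support : Set (Fin n)) m :=
      ⟨_, Finset.isGreatest_max' a.support ⟨l, Finsupp.mem_support_iff.2 hl0⟩⟩
    have him : i < m :=
      (Finset.mem_Ioi.1 hl).trans_le (hm.2 (Finsupp.mem_support_iff.2 hl0))
    have hle : Finsupp.single m 1 ≤ a := by
      simpa [Nat.one_le_iff_ne_zero] using hm.1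
    have hmem := isStable_truncation_iff.1 hst a ha hae m hm i him
    have hadd := tsub_add_cancel_of_le hle
    generalize a - Finsupp.single m 1 = c at hmem hadd
    subst hadd
    obtain ⟨b, hb, hb1, hb2⟩ := ih hmem (by simpa using hae) (by
      simp only [Finsupp.add_apply, Finset.sum_add_distrib] at hs ⊢
      rw [Finset.sum_eq_single_of_mem m (Finset.mem_Ioi.2 him)
        (fun l _ hl => Finsupp.single_eq_of_ne hl)] at hs
      rw [Finset.sum_eq_zero (s := Finset.Ioi i) (f := fun x => Finsupp.single i 1 x)
        (fun l hl => Finsupp.single_eq_of_ne (Finset.mem_Ioi.1 hl).ne')]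
      simp only [Finsupp.single_eq_same] at hs
      omega)
    refine ⟨b, hb, fun l hl => ?_, hb2⟩
    rw [hb1 l hl, Finsupp.add_apply, Finsupp.add_apply, Finsupp.single_eq_of_ne hl.ne,
      Finsupp.single_eq_of_ne (hl.trans him).ne]

theorem isBorelType_of_isStable_truncation (hI : IsMonomialIdeal I) {e : ℕ}
    (hst : IsStable (truncation I e)) : IsBorelType I := by
  refine isBorelType_iff.2 fun i j hij f ⟨k, hk⟩ => ?_
  rcases hij.eq_or_lt with rfl | hij
  · exact ⟨k, hk⟩
  rw [hI.X_pow_mul_mem_iff] at hk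
  have key : ∀ a ∈ f.support, ∃ N : ℕ, Finsupp.single i N + a ∈ exponents I := by
    intro a ha
    -- The factor `x_i^e` pushes the degree up to `e` and costs nothing, since only the exponent at
    -- `i` may grow.
    obtain ⟨b, hb, hb1, hb2⟩ := exists_mem_exponents_of_stable hst i
      (a := Finsupp.single i e + (Finsupp.single j k + a))
      (exponents_mono (hk a ha) le_add_self) (by simp)
    refine ⟨b i, exponents_mono hb fun l => ?_⟩
    rcases lt_trichotomy l i with h | rfl | h
    · simp [hb1 l h, Finsupp.single_eq_of_ne h.ne, Finsupp.single_eq_of_ne (h.trans hij).ne]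
    · simp
    · simp [hb2 l h]
  choose! N hN using key
  refine ⟨f.support.sup N, (hI.X_pow_mul_mem_iff i _).2 fun a ha =>
    exponents_mono (hN a ha) ?_⟩
  gcongr
  exact Finset.le_sup ha

/-- If `v ∉ I` but `x_m v ∈ I` for an ideal of Borel type, and `v` only involves variables up to
`x_m`, then `v` divides a monomial in these variables which is a socle element modulo `I`. -/
theorem IsBorelType.exists_socle (hB : IsBorelType I) (m : Fin n) {v : Fin n →₀ ℕ}
    (hv : v ∉ exponents I) (hvm : Finsupp.single m 1 + v ∈ exponents I)
    (hsupp : ∀ i, m < i → v i = 0) :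
    ∃ w, v ≤ w ∧ (∀ i, m < i → w i = 0) ∧ w ∉ exponents I ∧
      ∀ i ≤ m, Finsupp.single i 1 + w ∈ exponents I := by
  have key : ∀ i ≤ m, ∃ k : ℕ, Finsupp.single i k + v ∈ exponents I := by
    intro i hi
    obtain ⟨k, hk⟩ := isBorelType_iff.1 hB i m hi (monomial v (1 : K))
      ⟨1, by rw [X_pow_eq_monomial, monomial_mul, mul_one]; exact hvm⟩
    refine ⟨k, ?_⟩
    rwa [X_pow_eq_monomial, monomial_mul, mul_one] at hk
  choose! k hk using key
  -- A candidate `w` lies in the box below `v + k`: exceeding it at some `i ≤ m` would make `w` a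
  -- multiple of `x_i^(k i) x^v ∈ I`.
  have hfin : {w | v ≤ w ∧ (∀ i, m < i → w i = 0) ∧ w ∉ exponents I}.Finite := by
    refine (Set.finite_Iic (v + Finsupp.equivFunOnFinite.symm k)).subset ?_
    rintro w ⟨hvw, hw, hwI⟩ i
    by_contra! hlt
    simp only [Finsupp.add_apply, Finsupp.equivFunOnFinite_symm_apply_apply] at hlt
    have him : i ≤ m := by
      by_contra! h
      rw [hw i h] at hlt
      omega
    refine hwI (exponents_mono (hk i him) fun l => ?_)
    rcases eq_or_ne l i with rfl | hl
    · simp only [Finsupp.add_apply, Finsupp.single_eq_same]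
      omega
    · simpa [Finsupp.single_eq_of_ne hl] using hvw l
  obtain ⟨w, hvw, hw⟩ := hfin.exists_le_maximal ⟨le_rfl, hsupp, hv⟩
  refine ⟨w, hvw, hw.1.2.1, hw.1.2.2, fun i hi => ?_⟩
  by_contra hcon
  have := hw.2 ⟨hvw.trans le_add_self, fun l hl => ?_, hcon⟩ le_add_self i
  · simp at this
  · simp [hw.1.2.1 l hl, Finsupp.single_eq_of_ne (hi.trans_lt hl).ne']

end Monomials

/-! ### Signed simplicial chains and acyclicity of cones -/

section SimplicialDifferential

/-- The sign `(-1) ^ #{l ∈ G | l < k}` occurring in the Koszul differential. -/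
def koszulSign (R : Type*) [CommRing R] {n : ℕ} (G : Finset (Fin n)) (k : Fin n) : R :=
  (-1) ^ (G.filter (· < k)).card

theorem koszulSign_mul_self (R : Type*) [CommRing R] {n : ℕ} (G : Finset (Fin n)) (k : Fin n) :
    koszulSign R G k * koszulSign R G k = 1 := by
  rw [koszulSign, ← mul_pow]
  simp

theorem koszulSign_mul_insert (R : Type*) [CommRing R] {n : ℕ} {G : Finset (Fin n)} {k l : Fin n}
    (hk : k ∉ G) (hl : l ∉ G) (hkl : k ≠ l) :
    koszulSign R G k * koszulSign R (insert k G) l =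
      - (koszulSign R G l * koszulSign R (insert l G) k) := by
  rcases lt_or_gt_of_ne hkl with h | h
  · exact koszul_sign G k l hk h
  · exact (neg_eq_iff_eq_neg.2 (koszul_sign (R := R) G l k hl h)).symm

/-- The differential of the Koszul complex in a fixed multidegree: the augmented simplicial
differential on functions on finite sets of indices. -/
def simplicialD (K : Type*) [CommRing K] (n : ℕ) :
    (Finset (Fin n) → K) →ₗ[K] (Finset (Fin n) → K) where
  toFun z G := ∑ k ∈ Gᶜ, koszulSign K G k * z (insert k G)
  map_add' z w := by
    funext G
    simp [mul_add, Finset.sum_add_distrib]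
  map_smul' r z := by
    funext G
    simp [Finset.mul_sum, mul_left_comm]

theorem simplicialD_apply {K : Type*} [CommRing K] {n : ℕ} (z : Finset (Fin n) → K)
    (G : Finset (Fin n)) :
    simplicialD K n z G = ∑ k ∈ Gᶜ, koszulSign K G k * z (insert k G) := rfl

theorem simplicialD_simplicialD {K : Type*} [CommRing K] {n : ℕ} (z : Finset (Fin n) → K) :
    simplicialD K n (simplicialD K n z) = 0 := by
  funext G
  simp only [simplicialD_apply, Finset.mul_sum, Pi.zero_apply]
  rw [Finset.sum_sigma']
  refine Finset.sum_involution (fun p _ => ⟨p.2, p.1⟩) ?_ ?_ ?_ ?_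
  · rintro ⟨k, l⟩ h
    simp only [Finset.mem_sigma, Finset.mem_compl, Finset.mem_insert, not_or] at h
    dsimp only
    rw [Finset.insert_comm l k G]
    linear_combination z (insert k (insert l G)) *
      koszulSign_mul_insert K h.1 h.2.2 (Ne.symm h.2.1)
  · rintro ⟨k, l⟩ h _ he
    simp only [Finset.mem_sigma, Finset.mem_compl, Finset.mem_insert, not_or] at h
    simp only [Sigma.mk.injEq] at he
    exact h.2.1 he.1
  · rintro ⟨k, l⟩ h
    simp only [Finset.mem_sigma, Finset.mem_compl, Finset.mem_insert, not_or] at h ⊢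
    exact ⟨h.2.2, fun e => h.2.1 e.symm, h.1⟩
  · rintro ⟨k, l⟩ h
    rfl

/-- The family `Δ` of finite sets has no homology in size `i`: every cycle supported on the members
of size `i` is the boundary of a chain supported on the members of size `i + 1`. -/
def IsExactAt (K : Type*) [CommRing K] {n : ℕ} (Δ : Set (Finset (Fin n))) (i : ℕ) : Prop :=
  ∀ z : Finset (Fin n) → K, (∀ F, z F ≠ 0 → F ∈ Δ ∧ F.card = i) → simplicialD K n z = 0 →
    ∃ w : Finset (Fin n) → K, (∀ F, w F ≠ 0 → F ∈ Δ ∧ F.card = i + 1) ∧ simplicialD K n w = z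

/-- A cone has no homology. -/
theorem isExactAt_of_cone (K : Type*) [CommRing K] {n : ℕ} {Δ : Set (Finset (Fin n))} {i : ℕ}
    (k : Fin n) (h : ∀ F ∈ Δ, F.card = i → k ∉ F → insert k F ∈ Δ) : IsExactAt K Δ i := by
  intro z hz hd
  -- The contracting homotopy, wedge product with `e_k`. The identity at `G ∋ k` uses that `z` is a
  -- cycle, at `G \ {k}`; at `G ∌ k` only the term of `k` survives.
  refine ⟨fun G => if k ∈ G then koszulSign K (G.erase k) k * z (G.erase k) else 0, ?_, ?_⟩
  · intro F hF
    by_cases hk : k ∈ F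
    · simp only [if_pos hk] at hF
      obtain ⟨h1, h2⟩ := hz _ (right_ne_zero_of_mul hF)
      have h3 := h _ h1 h2 (Finset.notMem_erase k F)
      rw [Finset.insert_erase hk] at h3
      exact ⟨h3, by rw [← h2, Finset.card_erase_add_one hk]⟩
    · exact absurd (if_neg hk) hF
  · funext G
    rw [simplicialD_apply]
    by_cases hk : k ∈ G
    · obtain ⟨G, hkG, rfl⟩ : ∃ G', k ∉ G' ∧ insert k G' = G :=
        ⟨G.erase k, Finset.notMem_erase k G, Finset.insert_erase hk⟩
      have h0 := congrFun hd G
      rw [simplicialD_apply, ← Finset.insert_compl_insert hkG,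
        Finset.sum_insert (by simp), Pi.zero_apply] at h0
      have hterm : ∀ l ∈ (insert k G)ᶜ,
          (koszulSign K (insert k G) l * if k ∈ insert l (insert k G) then
            koszulSign K ((insert l (insert k G)).erase k) k *
              z ((insert l (insert k G)).erase k) else 0) =
          -(koszulSign K G k * (koszulSign K G l * z (insert l G))) := by
        intro l hl
        simp only [Finset.mem_compl, Finset.mem_insert, not_or] at hl
        have herase : (insert l (insert k G)).erase k = insert l G := by
          rw [Finset.insert_comm, Finset.erase_insert]
          simp [hkG, Ne.symm hl.1]
        rw [if_pos (by simp), herase]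
        have h1 := koszulSign_mul_insert K hkG hl.2 (Ne.symm hl.1)
        have h2 := koszulSign_mul_self K G k
        have h3 := koszulSign_mul_self K (insert l G) k
        linear_combination (koszulSign K (insert l G) k * koszulSign K G k * z (insert l G)) * h1
          - (koszulSign K (insert k G) l * koszulSign K (insert l G) k * z (insert l G)) * h2
          - koszulSign K G k * koszulSign K G l * z (insert l G) * h3
      rw [Finset.sum_congr rfl hterm, Finset.sum_neg_distrib, ← Finset.mul_sum]
      linear_combination (-koszulSign K G k) * h0 + z (insert k G) * koszulSign_mul_self K G k
    · rw [Finset.sum_eq_single_of_mem k (by simpa using hk)]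
      · rw [if_pos (Finset.mem_insert_self k G), Finset.erase_insert hk, ← mul_assoc,
          koszulSign_mul_self, one_mul]
      · intro l hl hlk
        rw [if_neg, mul_zero]
        simp [hk, Ne.symm hlk]

end SimplicialDifferential

/-! ### Multigraded decomposition of the Koszul complex -/

section Strands

variable {K : Type*} [Field K] {n : ℕ}

/-- The exponent vector of the squarefree monomial `∏ i ∈ F, x_i`. -/
noncomputable def squarefreeExponent (F : Finset (Fin n)) : Fin n →₀ ℕ :=
  ∑ i ∈ F, Finsupp.single i 1

theorem squarefreeExponent_apply (F : Finset (Fin n)) (i : Fin n) :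
    squarefreeExponent F i = if i ∈ F then 1 else 0 := by
  simp [squarefreeExponent, Finsupp.finsetSum_apply, Finsupp.single_apply]

theorem squarefreeExponent_insert {F : Finset (Fin n)} {k : Fin n} (hk : k ∉ F) :
    squarefreeExponent (insert k F) = Finsupp.single k 1 + squarefreeExponent F :=
  Finset.sum_insert hk

theorem degree_squarefreeExponent (F : Finset (Fin n)) :
    (squarefreeExponent F).degree = F.card := by
  simp [squarefreeExponent, map_sum]

/-- The upper Koszul simplicial complex of `I` in multidegree `a`. -/
def upperKoszul (I : Ideal (MvPolynomial (Fin n) K)) (a : Fin n →₀ ℕ) : Set (Finset (Fin n)) :=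
  {F | ∃ b ∈ exponents I, squarefreeExponent F + b = a}

/-- The component of multidegree `a` of an element of the Koszul complex. -/
noncomputable def strand (a : Fin n →₀ ℕ) :
    (Finset (Fin n) → MvPolynomial (Fin n) K) →ₗ[K] (Finset (Fin n) → K) where
  toFun c F := coeff a (monomial (squarefreeExponent F) (1 : K) * c F)
  map_add' c d := by
    funext F
    simp [mul_add]
  map_smul' r c := by
    funext F
    simp

theorem strand_apply (a : Fin n →₀ ℕ) (c : Finset (Fin n) → MvPolynomial (Fin n) K)
    (F : Finset (Fin n)) :
    strand a c F = coeff a (monomial (squarefreeExponent F) (1 : K) * c F) := rfl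

theorem strand_squarefreeExponent_add (b : Fin n →₀ ℕ)
    (c : Finset (Fin n) → MvPolynomial (Fin n) K) (F : Finset (Fin n)) :
    strand (squarefreeExponent F + b) c F = coeff b (c F) := by
  rw [strand_apply, coeff_monomial_mul, one_mul]

theorem ext_strand {c d : Finset (Fin n) → MvPolynomial (Fin n) K}
    (h : ∀ a, strand a c = strand a d) : c = d := by
  funext F
  ext b
  rw [← strand_squarefreeExponent_add, h, strand_squarefreeExponent_add]

/-- Giving `e_F` the weight `x^F` absorbs the factor `x_k` of the Koszul differential into `x^(G ∪
{k})`, leaving only the sign. -/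
theorem strand_koszulD (a : Fin n →₀ ℕ) (c : Finset (Fin n) → MvPolynomial (Fin n) K) :
    strand a (koszulD K n c) = simplicialD K n (strand a c) := by
  funext G
  rw [strand_apply, koszulD_apply, simplicialD_apply, Finset.mul_sum, coeff_sum]
  refine Finset.sum_congr rfl fun k hk => ?_
  have hkG : k ∉ G := by simpa using hk
  rw [strand_apply, squarefreeExponent_insert hkG, ← coeff_C_mul, koszulSign]
  congr 1
  rw [← one_mul (1 : K), ← monomial_mul, one_mul, ← X]
  simp only [map_pow, map_neg, map_one]
  ring

theorem exists_of_strand_ne_zero {a : Fin n →₀ ℕ} {c : Finset (Fin n) → MvPolynomial (Fin n) K}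
    {F : Finset (Fin n)} (h : strand a c F ≠ 0) :
    ∃ b ∈ (c F).support, squarefreeExponent F + b = a := by
  rw [strand_apply, coeff_monomial_mul'] at h
  split_ifs at h with hle
  · exact ⟨a - squarefreeExponent F, by simpa using h, add_tsub_cancel_of_le hle⟩
  · exact absurd rfl h

variable {I : Ideal (MvPolynomial (Fin n) K)}

theorem strand_ne_zero_of_mem_koszulChains (hI : IsMonomialIdeal I) {i j : ℕ}
    {c : Finset (Fin n) → MvPolynomial (Fin n) K} (hc : c ∈ koszulChains I i j)
    {a : Fin n →₀ ℕ} {F : Finset (Fin n)} (h : strand a c F ≠ 0) :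
    (F ∈ upperKoszul I a ∧ F.card = i) ∧ a.degree = j := by
  obtain ⟨b, hb, rfl⟩ := exists_of_strand_ne_zero h
  obtain ⟨h1, h2⟩ := hc F trivial
  rw [SetLike.mem_coe, mem_restrictSupport_iff] at h2
  obtain ⟨h3, h4⟩ := h2 hb
  refine ⟨⟨⟨b, hI.mem_iff.1 h1 b hb, rfl⟩, h3⟩, ?_⟩
  rw [map_add, degree_squarefreeExponent]
  omega

theorem strand_eq_zero_of_mem_koszulChains (hI : IsMonomialIdeal I) {i j : ℕ}
    {c : Finset (Fin n) → MvPolynomial (Fin n) K} (hc : c ∈ koszulChains I i j)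
    {a : Fin n →₀ ℕ} (ha : a.degree ≠ j) : strand a c = 0 := by
  funext F
  by_contra h
  exact ha (strand_ne_zero_of_mem_koszulChains hI hc h).2

/-- The element of the Koszul complex that is concentrated in multidegree `a`. -/
noncomputable def unstrand (a : Fin n →₀ ℕ) (z : Finset (Fin n) → K) :
    Finset (Fin n) → MvPolynomial (Fin n) K :=
  fun F => monomial (a - squarefreeExponent F) (z F)

theorem strand_unstrand {a : Fin n →₀ ℕ} {z : Finset (Fin n) → K}
    (hz : ∀ F, z F ≠ 0 → F ∈ upperKoszul I a) (a' : Fin n →₀ ℕ) :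
    strand a' (unstrand a z) = if a = a' then z else 0 := by
  funext F
  rw [strand_apply, unstrand, monomial_mul, one_mul]
  by_cases h : z F = 0
  · split_ifs <;> simp [h]
  · obtain ⟨b, -, rfl⟩ := hz F h
    rw [add_tsub_cancel_left, coeff_monomial]
    split_ifs <;> rfl

theorem unstrand_mem_koszulChains {a : Fin n →₀ ℕ} {z : Finset (Fin n) → K} {i : ℕ}
    (hz : ∀ F, z F ≠ 0 → F ∈ upperKoszul I a ∧ F.card = i) :
    unstrand a z ∈ koszulChains I i a.degree := by
  intro F _
  by_cases h : z F = 0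
  · simp [unstrand, h]
  · obtain ⟨⟨b, hb, rfl⟩, hF⟩ := hz F h
    rw [unstrand, add_tsub_cancel_left]
    refine ⟨monomial_mem_of_mem_exponents hb _, ?_⟩
    rw [SetLike.mem_coe, mem_restrictSupport_iff]
    intro b' hb'
    have : b' = b := by simpa using support_monomial_subset hb'
    subst this
    refine ⟨hF, ?_⟩
    rw [map_add, degree_squarefreeExponent]
    omega

/-- Only finitely many multidegrees have total degree `j`, so primitives chosen in each of them add
up to an element of the Koszul complex. -/
theorem koszulCycles_le_koszulBoundaries (hI : IsMonomialIdeal I) {i j : ℕ}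
    (h : ∀ a : Fin n →₀ ℕ, a.degree = j → IsExactAt K (upperKoszul I a) i) :
    koszulCycles I i j ≤ koszulBoundaries I i j := by
  rintro c ⟨hc, hd⟩
  have hd' : koszulD K n c = 0 := hd
  have hex : ∀ a : Fin n →₀ ℕ, a.degree = j → ∃ w : Finset (Fin n) → K,
      (∀ F, w F ≠ 0 → F ∈ upperKoszul I a ∧ F.card = i + 1) ∧
        simplicialD K n w = strand a c := by
    intro a ha
    refine h a ha _ (fun F hF => (strand_ne_zero_of_mem_koszulChains hI hc hF).1) ?_
    rw [← strand_koszulD, hd', map_zero]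
  choose! w hw hwd using hex
  have hfin := Finsupp.finite_of_degree_eq (σ := Fin n) j
  have hmem : ∀ a, a ∈ hfin.toFinset ↔ a.degree = j := fun a => hfin.mem_toFinset
  refine ⟨∑ a ∈ hfin.toFinset, unstrand a (w a), ?_, ext_strand fun a => ?_⟩
  · refine Submodule.sum_mem _ fun a ha => ?_
    rw [← (hmem a).1 ha]
    exact unstrand_mem_koszulChains (hw a ((hmem a).1 ha))
  · change strand a (koszulD K n _) = _
    rw [strand_koszulD, map_sum, Finset.sum_congr rfl fun a' ha' =>
      strand_unstrand (fun F hF => (hw a' ((hmem a').1 ha') F hF).1) a, Finset.sum_ite_eq']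
    split_ifs with ha
    · exact hwd a ((hmem a).1 ha)
    · rw [map_zero, strand_eq_zero_of_mem_koszulChains hI hc (mt (hmem a).2 ha)]

/-- Needed because `finrank` is `0` by default in infinite dimension; only with finiteness does a
nonzero Betti number detect homology. -/
theorem finite_koszulCycles (hI : IsMonomialIdeal I) (i j : ℕ) :
    Module.Finite K (koszulCycles I i j) := by
  have : Finite {a : Fin n →₀ ℕ // a.degree = j} := Finsupp.finite_of_degree_eq j
  let φ : koszulCycles I i j →ₗ[K] ({a : Fin n →₀ ℕ // a.degree = j} → Finset (Fin n) → K) :=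
    (LinearMap.pi fun a => strand a.1) ∘ₗ (koszulCycles I i j).subtype
  refine Module.Finite.of_injective φ fun c d hcd => Subtype.ext (ext_strand fun a => ?_)
  by_cases ha : a.degree = j
  · exact congrFun hcd ⟨a, ha⟩
  · rw [strand_eq_zero_of_mem_koszulChains hI c.2.1 ha,
      strand_eq_zero_of_mem_koszulChains hI d.2.1 ha]

/-- Betti numbers in terms of the upper Koszul simplicial complexes. -/
theorem gradedBetti_ne_zero_iff (hI : IsMonomialIdeal I) {i j : ℕ} :
    gradedBetti I i j ≠ 0 ↔
      ∃ a : Fin n →₀ ℕ, a.degree = j ∧ ¬ IsExactAt K (upperKoszul I a) i := by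
  have := finite_koszulCycles hI i j
  rw [gradedBetti, ← Nat.pos_iff_ne_zero, Module.finrank_pos_iff, Submodule.Quotient.nontrivial_iff,
    Ne, Submodule.submoduleOf_eq_top]
  constructor
  · intro hne
    by_contra! hcon
    exact hne (koszulCycles_le_koszulBoundaries hI hcon)
  · rintro ⟨a, rfl, hex⟩ hle
    refine hex fun z hz hd => ?_
    have hz' : ∀ F, z F ≠ 0 → F ∈ upperKoszul I a := fun F hF => (hz F hF).1
    have hcyc : unstrand a z ∈ koszulCycles I i a.degree := by
      refine ⟨unstrand_mem_koszulChains hz, ext_strand fun a' => ?_⟩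
      change strand a' (koszulD K n _) = _
      rw [strand_koszulD, strand_unstrand hz', map_zero]
      split_ifs
      · exact hd
      · exact map_zero _
    obtain ⟨w, hw, hwd⟩ := hle hcyc
    refine ⟨strand a w, fun F hF => (strand_ne_zero_of_mem_koszulChains hI hw hF).1, ?_⟩
    rw [← strand_koszulD]
    change strand a (((koszulD K n).restrictScalars K) w) = z
    rw [hwd, strand_unstrand hz', if_pos rfl]

end Strands

/-! ### Bounds on the regularity -/

section Regularity

variable {K : Type*} [Field K] {n : ℕ} {I : Ideal (MvPolynomial (Fin n) K)}

/-- A vertex `k` such that `x_k` divides `x^b` and `x^b / x_k ∈ I` for all monomials `x^b ∈ I`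
arising from faces without `k` is the apex of a cone. -/
theorem isExactAt_upperKoszul {a : Fin n →₀ ℕ} {i : ℕ} (k : Fin n)
    (h : ∀ F : Finset (Fin n), F.card = i → k ∉ F → ∀ b ∈ exponents I,
      squarefreeExponent F + b = a → ∃ c ∈ exponents I, Finsupp.single k 1 + c = b) :
    IsExactAt K (upperKoszul I a) i := by
  refine isExactAt_of_cone K k ?_
  rintro F ⟨b, hb, hba⟩ hF hk
  obtain ⟨c, hc, rfl⟩ := h F hF hk b hb hba
  refine ⟨c, hc, ?_⟩
  rw [squarefreeExponent_insert hk, ← hba]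
  abel

/-- Without boundedness the supremum in `regularity` would default to `0`. If `a k` exceeds the
bound of `exists_exponent_bound`, one `x_k` can be removed without leaving `I`, so `k` is a cone
apex; hence only multidegrees in a box contribute. -/
theorem bddAbove_regularity_set (hI : IsMonomialIdeal I) :
    BddAbove {r | ∃ i j : ℕ, gradedBetti I i j ≠ 0 ∧ j = i + r} := by
  obtain ⟨B, hB⟩ := exists_exponent_bound I
  refine ⟨∑ _i : Fin n, B, ?_⟩
  rintro r ⟨i, j, hb, rfl⟩
  obtain ⟨a, ha, hex⟩ := (gradedBetti_ne_zero_iff hI).1 hb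
  have hle : ∀ k, a k ≤ B := by
    intro k
    by_contra! hlt
    refine hex (isExactAt_upperKoszul k fun F _ hk b hb hba => ?_)
    have hbk : b k = a k := by
      rw [← hba, Finsupp.add_apply, squarefreeExponent_apply, if_neg hk, zero_add]
    refine ⟨b - Finsupp.single k 1, hB b _ k hb ?_ ?_, add_tsub_cancel_of_le ?_⟩
    · simp only [Finsupp.tsub_apply, Finsupp.single_eq_same]
      omega
    · intro l hl
      simp [Finsupp.single_eq_of_ne hl]
    · rw [Finsupp.single_le_iff]
      omega
  have := Finset.sum_le_sum fun k (_ : k ∈ Finset.univ) => hle k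
  rw [← Finsupp.degree_eq_sum, ha] at this
  omega

theorem le_regularity (hI : IsMonomialIdeal I) {a : Fin n →₀ ℕ} {i r : ℕ}
    (ha : a.degree = i + r) (h : ¬ IsExactAt K (upperKoszul I a) i) : r ≤ regularity I :=
  le_csSup (bddAbove_regularity_set hI)
    ⟨i, i + r, (gradedBetti_ne_zero_iff hI).2 ⟨a, ha, h⟩, rfl⟩

/-- In the multidegree of a minimal generator the empty face is present but no vertex is, since a
vertex would give a proper divisor in `I`. So the empty face is a cycle that does not bound. -/
theorem maxGenDegree_le_regularity (hI : IsMonomialIdeal I) :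
    maxGenDegree I ≤ regularity I := by
  refine csSup_le' ?_
  rintro _ ⟨a, ha, rfl⟩
  refine le_regularity hI (i := 0) (a := a) (zero_add _).symm fun hex => ?_
  have hempty : (∅ : Finset (Fin n)) ∈ upperKoszul I a := ⟨a, ha.1, by simp [squarefreeExponent]⟩
  obtain ⟨w, hw, hwd⟩ := hex (Pi.single ∅ 1)
    (fun F hF => by
      obtain rfl : F = ∅ := by
        by_contra hne
        exact hF (Pi.single_eq_of_ne hne _)
      exact ⟨hempty, rfl⟩)
    (by
      funext G
      exact Finset.sum_eq_zero fun k _ => by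
        rw [Pi.single_eq_of_ne (Finset.insert_ne_empty k G), mul_zero])
  have hw0 : w = 0 := by
    funext F
    by_contra hF
    obtain ⟨⟨b, hb, hba⟩, hcard⟩ := hw F hF
    have hle : b ≤ a := hba ▸ le_add_self
    have hab := ha.2 hb hle
    have := congrArg Finsupp.degree hba
    rw [map_add, degree_squarefreeExponent, le_antisymm hle hab] at this
    omega
  have := congrFun hwd ∅
  rw [hw0, map_zero] at this
  simp at this

/-- A stable truncation has a linear resolution, hence bounds the regularity. -/
theorem regularity_le_of_isStable_truncation (hI : IsMonomialIdeal I) {e : ℕ}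
    (he : maxGenDegree I ≤ e) (hst : IsStable (truncation I e)) : regularity I ≤ e := by
  refine csSup_le' ?_
  rintro r ⟨i, j, hb, rfl⟩
  obtain ⟨a, ha, hex⟩ := (gradedBetti_ne_zero_iff hI).1 hb
  by_contra! hr
  have hne : a.support.Nonempty := by
    rw [Finsupp.support_nonempty_iff]
    rintro rfl
    rw [map_zero] at ha
    omega
  have hm := Finset.isGreatest_max' a.support hne
  generalize a.support.max' hne = m at hm
  -- The apex is the last variable of `a`; it remains to show `x^b / x_m ∈ I` for each face of size
  -- `i` avoiding `m`, where `x^b` has degree `r > e`.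
  refine hex (isExactAt_upperKoszul m fun F hF hmF b hb hba => ?_)
  have hbdeg : b.degree = r := by
    rw [← hba, map_add, degree_squarefreeExponent] at ha
    omega
  have hbm : b m = a m := by
    rw [← hba, Finsupp.add_apply, squarefreeExponent_apply, if_neg hmF, zero_add]
  have hbm0 : b m ≠ 0 := by
    rw [hbm]
    exact Finsupp.mem_support_iff.1 hm.1
  have hba' : b ≤ a := hba ▸ le_add_self
  suffices b - Finsupp.single m 1 ∈ exponents I from
    ⟨_, this, add_tsub_cancel_of_le (by rw [Finsupp.single_le_iff]; omega)⟩
  -- Since `r > deg(I)`, some `x_k` can be removed inside `I`. If `k < m`, stability applied to `x^b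
  -- / x_k`, of degree `r - 1 ≥ e`, exchanges `x_m` for `x_k` and gives `x^b / x_m`.
  obtain ⟨k, hk, hkI⟩ := exists_tsub_single_mem_exponents hb (by omega)
  have hkb : Finsupp.single k 1 ≤ b := by
    simpa [Nat.one_le_iff_ne_zero] using hk
  have hka : k ∈ a.support :=
    Finsupp.mem_support_iff.2 fun h0 => Finsupp.mem_support_iff.1 hk
      (Nat.le_zero.1 (h0 ▸ hba' k))
  rcases (hm.2 hka).eq_or_lt with rfl | hkm
  · exact hkI
  obtain ⟨c, rfl⟩ := exists_add_of_le hkb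
  rw [add_tsub_cancel_left] at hkI
  have hcm : c m ≠ 0 := by
    simpa [Finsupp.single_eq_of_ne hkm.ne'] using hbm0
  have hgr : IsGreatest (c.support : Set (Fin n)) m := by
    refine ⟨Finsupp.mem_support_iff.2 hcm, fun l hl => hm.2 ?_⟩
    refine Finsupp.mem_support_iff.2 fun h0 => Finsupp.mem_support_iff.1 hl ?_
    have := h0 ▸ hba' l
    rw [Finsupp.add_apply] at this
    omega
  have hdeg : e ≤ c.degree := by
    rw [map_add, Finsupp.degree_single] at hbdeg
    omega
  have := isStable_truncation_iff.1 hst c hkI hdeg m hgr k hkm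
  rwa [tsub_add_eq_add_tsub (Finsupp.single_le_iff.2 (by omega)), add_comm c] at this

/-- A monomial `x^w ∉ I` in `x_1, …, x_m` which is a socle element modulo `I` with respect to these
variables contributes to the regularity. -/
theorem degree_lt_regularity_of_socle (hI : IsMonomialIdeal I) (m : Fin n) {w : Fin n →₀ ℕ}
    (hwm : ∀ i, m < i → w i = 0) (hw : w ∉ exponents I)
    (hsocle : ∀ i ≤ m, Finsupp.single i 1 + w ∈ exponents I) :
    w.degree + 1 ≤ regularity I := by
  have hcard : (Finset.Iic m).card = m + 1 := Fin.card_Iic m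
  -- Indices start at `0`, so the full face has `m + 1` elements and its boundary has size `m`; this
  -- is the extra `1` beside `w.degree`.
  refine le_regularity hI (i := m) (a := squarefreeExponent (Finset.Iic m) + w) ?_ fun hex => ?_
  · rw [map_add, degree_squarefreeExponent, hcard]
    ring
  have hsub : ∀ F ∈ upperKoszul I (squarefreeExponent (Finset.Iic m) + w), F ⊆ Finset.Iic m := by
    rintro F ⟨b, -, hb⟩ i hi
    by_contra hcon
    have := DFunLike.congr_fun hb i
    simp only [Finsupp.add_apply, squarefreeExponent_apply, if_pos hi, if_neg hcon,
      hwm i (by simpa using hcon)] at this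
    omega
  -- The complex is a hollow simplex: the socle condition supplies all facets, while `w ∉ exponents
  -- I` excludes the full face. Its boundary is thus a cycle with no chain available to fill it.
  obtain ⟨z, hz, hzd⟩ := hex (simplicialD K n (Pi.single (Finset.Iic m) 1))
    (fun F hF => by
      rw [simplicialD_apply] at hF
      obtain ⟨k, hk, hkF⟩ := Finset.exists_ne_zero_of_sum_ne_zero hF
      have hkF' : insert k F = Finset.Iic m := by
        by_contra hne
        exact hkF (by rw [Pi.single_eq_of_ne hne, mul_zero])
      have hk' : k ∉ F := by simpa using hk
      refine ⟨⟨Finsupp.single k 1 + w, hsocle k ?_, ?_⟩, ?_⟩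
      · exact Finset.mem_Iic.1 (hkF' ▸ Finset.mem_insert_self k F)
      · rw [← hkF', squarefreeExponent_insert hk']
        abel
      · rw [← hkF', Finset.card_insert_of_notMem hk'] at hcard
        omega)
    (simplicialD_simplicialD _)
  have hz0 : z = 0 := by
    funext F
    by_contra hF
    obtain ⟨hF1, hF2⟩ := hz F hF
    obtain rfl := Finset.eq_of_subset_of_card_le (hsub F hF1) (by omega)
    obtain ⟨b, hb, hbw⟩ := hF1
    rw [add_left_cancel hbw] at hb
    exact hw hb
  have := congrFun hzd ((Finset.Iic m).erase m)
  have hins : insert m ((Finset.Iic m).erase m) = Finset.Iic m := Finset.insert_erase (by simp)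
  rw [hz0, map_zero, simplicialD_apply, Finset.sum_eq_single_of_mem m (by simp), hins,
    Pi.single_eq_same, mul_one, Pi.zero_apply] at this
  · have h1 := koszulSign_mul_self K ((Finset.Iic m).erase m) m
    rw [← this, mul_zero] at h1
    exact zero_ne_one h1
  · intro l hl hlm
    rw [Pi.single_eq_of_ne, mul_zero]
    intro heq
    have hmem : m ∈ Finset.Iic m := Finset.mem_Iic.2 le_rfl
    rw [← heq, Finset.mem_insert] at hmem
    exact hmem.elim (Ne.symm hlm) (Finset.notMem_erase m _)

/-- If `x_m v ∈ I` has degree at least `reg(I)` but `x_j v ∉ I`, then `x_m (x_j v) ∈ I`, so `x_j v`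
divides a socle monomial. Its degree is at least `reg(I)`, contradicting
`degree_lt_regularity_of_socle`. -/
theorem IsBorelType.isStable_truncation_regularity (hI : IsMonomialIdeal I) (hB : IsBorelType I) :
    IsStable (truncation I (regularity I)) := by
  refine isStable_truncation_iff.2 fun a ha hae m hm j hj => ?_
  have hle : Finsupp.single m 1 ≤ a := by
    simpa [Nat.one_le_iff_ne_zero] using hm.1
  obtain ⟨v, rfl⟩ := exists_add_of_le hle
  rw [add_tsub_cancel_left]
  by_contra hv
  have hsupp : ∀ i, m < i → v i = 0 := by
    intro i hi
    by_contra h0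
    exact absurd (hm.2 (Finsupp.mem_support_iff.2
      (by rw [Finsupp.add_apply]; omega))) hi.not_ge
  obtain ⟨w, hvw, hw1, hw2, hw3⟩ := hB.exists_socle m hv
    (exponents_mono ha (by rw [← add_assoc]; exact le_self_add))
    (fun i hi => by
      rw [Finsupp.add_apply, hsupp i hi, Finsupp.single_eq_of_ne (hj.trans hi).ne', add_zero])
  have h1 := degree_lt_regularity_of_socle hI m hw1 hw2 hw3
  have h2 := Finsupp.degree_mono hvw
  simp only [map_add, Finsupp.degree_single] at h2 hae
  omega

end Regularity

end BorelType

theorem theorem1p5 {K : Type*} [Field K] [Infinite K] {n : ℕ} (hn : 2 ≤ n)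
    (I : Ideal (MvPolynomial (Fin n) K)) (hI : BorelType.IsMonomialIdeal I) (hI0 : I ≠ ⊥) :
    List.TFAE
      [BorelType.IsBorelType I,
       BorelType.IsStable (BorelType.truncation I (BorelType.regularity I)),
       ∃ e : ℕ, BorelType.maxGenDegree I ≤ e ∧ BorelType.IsStable (BorelType.truncation I e)] ∧
    (BorelType.IsBorelType I →
      IsLeast {e : ℕ | BorelType.maxGenDegree I ≤ e ∧
        BorelType.IsStable (BorelType.truncation I e)} (BorelType.regularity I)) := by
  refine ⟨?_, fun hB => ⟨⟨BorelType.maxGenDegree_le_regularity hI,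
    hB.isStable_truncation_regularity hI⟩,
    fun e he => BorelType.regularity_le_of_isStable_truncation hI he.1 he.2⟩⟩
  tfae_have 1 → 2 := fun hB => hB.isStable_truncation_regularity hI
  tfae_have 2 → 3 := fun h => ⟨_, BorelType.maxGenDegree_le_regularity hI, h⟩
  tfae_have 3 → 1 := fun ⟨_, _, h⟩ => BorelType.isBorelType_of_isStable_truncation hI h
  tfae_finish
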